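/- Let $\Gamma$ be a finitely generated group. Let $\mathcal{P}(\Gamma)$ be the complex vector space of parallelogram functions, i.e. functions $f\colon\Gamma\to\mathbb{C}$ with $$f(xy)+f(xy^{-1})=2f(x)+2f(y)\qquad\text{for all }x,y\in\Gamma,$$ and let $\mathcal{Q}(\Gamma)$ be the space of quadratic forms, i.e. functions of the form $f(\gamma)=b(\gamma,\gamma)$ with $b\colon\Gamma\times\Gamma\to\mathbb{C}$ a morphism to $(\mathbb{C},+)$ in each variable. Extend every $f\colon\Gamma\to\mathbb{C}$ linearly to the group algebra $\mathbb{C}[\Gamma]$. Let $c\colon H_2(\Gamma,\mathbb{C})\to\Lambda^2H_1(\Gamma,\mathbb{C})$ be the dual of the cup product $H^1(\Gamma,\mathbb{C})\times H^1(\Gamma,\mathbb{C})\to H^2(\Gamma,\mathbb{C})$, that is, $\langle\alpha\wedge\beta,c(y)\rangle=\langle\alpha\cup\beta,y\rangle$ for all $\alpha,\beta\in H^1(\Gamma,\mathbb{C})$ and $y\in H_2(\Gamma,\mathbb{C})$; explicitly, $c$ sends the class of a $2$-cycle $\sum_i z_i[g_i|h_i]$ of the bar complex to $\frac12\sum_i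 z_i\,[g_i]\wedge[h_i]$, where $[g]\in H_1(\Gamma,\mathbb{C})$ is the class of $g\in\Gamma$. Then $\mathcal{Q}(\Gamma)\subset\mathcal{P}(\Gamma)$, and there is a linear map $\varepsilon_3^*\colon\mathcal{P}(\Gamma)\to(\Lambda^3H_1(\Gamma,\mathbb{C}))^*$ with $$\varepsilon_3^*(f)([\gamma_1]\wedge[\gamma_2]\wedge[\gamma_3])=f\big((\gamma_1-1)(\gamma_2-1)(\gamma_3-1)\big)\qquad\text{for all }f\in\mathcal{P}(\Gamma),\ \gamma_1,\gamma_2,\gamma_3\in\Gamma,$$ such that the sequence $$0\to\mathcal{Q}(\Gamma)\to\mathcal{P}(\Gamma)\xrightarrow{\ \varepsilon_3^*\ }(\Lambda^3H_1(\Gamma,\mathbb{C}))^*$$ is exact. The image of $\varepsilon_3^*$ is the space $$\mathcal{E}(\Gamma)=\{\Phi\colon\Lambda^3H_1(\Gamma,\mathbb{C})\to\mathbb{C}\ \text{linear}\mid \Phi(x\wedge c(y))=0\ \text{for all }x\in H_1(\Gamma,\mathbb{C}),\ y\in H_2(\Gamma,\mathbb{C})\}.$$ -/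

import Mathlib

noncomputable section

namespace Parallelogram

/-! ### Parallelogram functions and quadratic forms on a group -/

/-- `𝒫(Γ)`: the functions `f : Γ → ℂ` with `f(xy) + f(xy⁻¹) = 2 f(x) + 2 f(y)`. -/
def parallelogramFunctions (Γ : Type) [Group Γ] : Submodule ℂ (Γ → ℂ) where
  carrier := {f | ∀ x y : Γ, f (x * y) + f (x * y⁻¹) = 2 * f x + 2 * f y}
  zero_mem' := by intro x y; simp
  add_mem' := by
    intro f g hf hg x y
    simp only [Pi.add_apply]
    linear_combination hf x y + hg x y
  smul_mem' := by
    intro r f hf x y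
    simp only [Pi.smul_apply, smul_eq_mul]
    linear_combination r * hf x y

/-- `b : Γ × Γ → ℂ` is a bimorphism: a morphism to `(ℂ, +)` in each variable. -/
def IsBimorphism {Γ : Type} [Group Γ] (b : Γ → Γ → ℂ) : Prop :=
  (∀ x y z, b (x * y) z = b x z + b y z) ∧ (∀ x y z, b x (y * z) = b x y + b x z)

/-- `𝒬(Γ)`: the functions `γ ↦ b(γ, γ)` with `b` a bimorphism. -/
def quadraticForms (Γ : Type) [Group Γ] : Submodule ℂ (Γ → ℂ) where
  carrier := {f | ∃ b : Γ → Γ → ℂ, IsBimorphism b ∧ ∀ x, f x = b x x}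
  zero_mem' := ⟨fun _ _ => 0, ⟨by simp, by simp⟩, by simp⟩
  add_mem' := by
    rintro f g ⟨b, ⟨h1, h2⟩, hf⟩ ⟨b', ⟨h1', h2'⟩, hg⟩
    refine ⟨fun x y => b x y + b' x y, ⟨fun x y z => ?_, fun x y z => ?_⟩, fun x => ?_⟩
    · simp only [h1, h1']; ring
    · simp only [h2, h2']; ring
    · simp [hf, hg]
  smul_mem' := by
    rintro r f ⟨b, ⟨h1, h2⟩, hf⟩
    refine ⟨fun x y => r * b x y, ⟨fun x y z => ?_, fun x y z => ?_⟩, fun x => ?_⟩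
    · simp only [h1]; ring
    · simp only [h2]; ring
    · simp [hf]

theorem quadraticForms_le (Γ : Type) [Group Γ] :
    quadraticForms Γ ≤ parallelogramFunctions Γ := by
  rintro f ⟨b, ⟨h1, h2⟩, hf⟩ x y
  have e1 : ∀ z, b y⁻¹ z = - b y z := fun z => by
    have h := h1 y y⁻¹ z
    have h' := h1 1 1 z
    simp only [mul_inv_cancel, mul_one] at h h'
    linear_combination -h - h'
  have e2 : ∀ z, b z y⁻¹ = - b z y := fun z => by
    have h := h2 z y y⁻¹
    have h' := h2 z 1 1
    simp only [mul_inv_cancel, mul_one] at h h'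
    linear_combination -h - h'
  simp only [hf, h1, h2, e1, e2]
  ring

/-- The linear extension of `f : Γ → ℂ` to the group algebra `ℂ[Γ]`. -/
def linearize {Γ : Type} (f : Γ → ℂ) : MonoidAlgebra ℂ Γ →ₗ[ℂ] ℂ :=
  Finsupp.linearCombination ℂ f ∘ₗ (MonoidAlgebra.coeffLinearEquiv ℂ).toLinearMap

/-- `ε₃(γ₁, γ₂, γ₃) = (γ₁ - 1)(γ₂ - 1)(γ₃ - 1)` in the group algebra `ℂ[Γ]`. -/
def eps3 {Γ : Type} [Group Γ] (a b c : Γ) : MonoidAlgebra ℂ Γ :=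
  (MonoidAlgebra.of ℂ Γ a - 1) * (MonoidAlgebra.of ℂ Γ b - 1) * (MonoidAlgebra.of ℂ Γ c - 1)

/-! ### Homology and cohomology with trivial complex coefficients -/

/-- The trivial representation of `Γ` on `ℂ`. -/
abbrev trivRep (Γ : Type) [Group Γ] : Rep ℂ Γ := Rep.trivial ℂ Γ ℂ

/-- `H₁(Γ, ℂ)`. -/
abbrev hlg1 (Γ : Type) [Group Γ] : ModuleCat ℂ := groupHomology.H1 (trivRep Γ)

/-- `H₂(Γ, ℂ)`. -/
abbrev hlg2 (Γ : Type) [Group Γ] : ModuleCat ℂ := groupHomology.H2 (trivRep Γ)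

/-- `H¹(Γ, ℂ)`. -/
abbrev cohlg1 (Γ : Type) [Group Γ] : ModuleCat ℂ := groupCohomology.H1 (trivRep Γ)

/-- `H²(Γ, ℂ)`. -/
abbrev cohlg2 (Γ : Type) [Group Γ] : ModuleCat ℂ := groupCohomology.H2 (trivRep Γ)

/-- The class in `H₁(Γ, ℂ)` of a group element. -/
def cls {Γ : Type} [Group Γ] (g : Γ) : hlg1 Γ :=
  groupHomology.H1π (trivRep Γ)
    ((groupHomology.cycles₁IsoOfIsTrivial (trivRep Γ)).inv (Finsupp.single g (1 : ℂ)))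

theorem cls_mul {Γ : Type} [Group Γ] (g h : Γ) : cls (g * h) = cls g + cls h := by
  have := (groupHomology.mkH1OfIsTrivial (trivRep Γ)).map_add
    (Additive.ofMul (Abelianization.of g)) (Additive.ofMul (Abelianization.of h))
  exact congrArg (fun φ => φ (1 : ℂ)) this

/-- A linear map `φ` on `Z` that kills the kernel of a surjection `p : Z → H` descends to `H`. -/
def descend {Z H M : Type*} [AddCommGroup Z] [Module ℂ Z] [AddCommGroup H] [Module ℂ H]
    [AddCommGroup M] [Module ℂ M] (p : Z →ₗ[ℂ] H) (hp : Function.Surjective p)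
    (φ : Z →ₗ[ℂ] M) (h : ∀ z, p z = 0 → φ z = 0) : H →ₗ[ℂ] M :=
  (LinearMap.ker p).liftQ φ (fun z hz => h z hz) ∘ₗ
    (p.quotKerEquivOfSurjective hp).symm.toLinearMap

theorem descend_apply {Z H M : Type*} [AddCommGroup Z] [Module ℂ Z] [AddCommGroup H] [Module ℂ H]
    [AddCommGroup M] [Module ℂ M] (p : Z →ₗ[ℂ] H) (hp : Function.Surjective p)
    (φ : Z →ₗ[ℂ] M) (h : ∀ z, p z = 0 → φ z = 0) (z : Z) :
    descend p hp φ h (p z) = φ z := by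
  have : (p.quotKerEquivOfSurjective hp).symm (p z) = (LinearMap.ker p).mkQ z := by
    rw [LinearEquiv.symm_apply_eq]; rfl
  simp only [descend, LinearMap.comp_apply, LinearEquiv.coe_coe, this]
  rfl

theorem H1π_surjective (Γ : Type) [Group Γ] :
    Function.Surjective (groupHomology.H1π (trivRep Γ)).hom :=
  (ModuleCat.epi_iff_surjective _).1 inferInstance

theorem H2π_surjective (Γ : Type) [Group Γ] :
    Function.Surjective (groupHomology.H2π (trivRep Γ)).hom :=
  (ModuleCat.epi_iff_surjective _).1 inferInstance

theorem cohH2π_surjective (Γ : Type) [Group Γ] :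
    Function.Surjective (groupCohomology.H2π (trivRep Γ)).hom :=
  (ModuleCat.epi_iff_surjective _).1 inferInstance

theorem linearCombination_d₂₁ {Γ M : Type} [Group Γ] [AddCommGroup M] [Module ℂ M] (F : Γ → M)
    (x : Γ × Γ →₀ ℂ) :
    Finsupp.linearCombination ℂ F ((groupHomology.d₂₁ (trivRep Γ)).hom x) =
      Finsupp.linearCombination ℂ (fun p : Γ × Γ => F p.2 - F (p.1 * p.2) + F p.1) x := by
  suffices Finsupp.linearCombination ℂ F ∘ₗ (groupHomology.d₂₁ (trivRep Γ)).hom =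
      Finsupp.linearCombination ℂ (fun p : Γ × Γ => F p.2 - F (p.1 * p.2) + F p.1) from
    LinearMap.congr_fun this x
  refine Finsupp.lhom_ext fun p a => ?_
  have h : (groupHomology.d₂₁ (trivRep Γ)).hom (Finsupp.single p a) =
      (Finsupp.single p.2 a - Finsupp.single (p.1 * p.2) a + Finsupp.single p.1 a : Γ →₀ ℂ) :=
    groupHomology.d₂₁_single (A := trivRep Γ) p a
  refine (congrArg (Finsupp.linearCombination ℂ F) h).trans ?_
  simp only [map_add, map_sub, Finsupp.linearCombination_single, smul_add, smul_sub]

theorem linearCombination_d₃₂ {Γ M : Type} [Group Γ] [AddCommGroup M] [Module ℂ M]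
    (F : Γ × Γ → M) (hF : ∀ g h j, F (h, j) - F (g * h, j) + F (g, h * j) - F (g, h) = 0)
    (x : Γ × Γ × Γ →₀ ℂ) :
    Finsupp.linearCombination ℂ F ((groupHomology.d₃₂ (trivRep Γ)).hom x) = 0 := by
  suffices Finsupp.linearCombination ℂ F ∘ₗ (groupHomology.d₃₂ (trivRep Γ)).hom = 0 from
    LinearMap.congr_fun this x
  refine Finsupp.lhom_ext fun p a => ?_
  have h : (groupHomology.d₃₂ (trivRep Γ)).hom (Finsupp.single p a) =
      (Finsupp.single (p.2.1, p.2.2) a - Finsupp.single (p.1 * p.2.1, p.2.2) a +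
        Finsupp.single (p.1, p.2.1 * p.2.2) a - Finsupp.single (p.1, p.2.1) a : Γ × Γ →₀ ℂ) :=
    groupHomology.d₃₂_single (A := trivRep Γ) p a
  refine (congrArg (Finsupp.linearCombination ℂ F) h).trans ?_
  simp only [map_add, map_sub, Finsupp.linearCombination_single, ← smul_add, ← smul_sub,
    LinearMap.zero_apply, hF, smul_zero]

/-- `x ∧ y` in `Λ² V`. -/
abbrev wedge2 {V : Type} [AddCommGroup V] [Module ℂ V] (x y : V) : ⋀[ℂ]^2 V :=
  exteriorPower.ιMulti ℂ 2 ![x, y]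

theorem wedge2_add_left {V : Type} [AddCommGroup V] [Module ℂ V] (x x' y : V) :
    wedge2 (x + x') y = wedge2 x y + wedge2 x' y :=
  Subtype.ext (by simp [wedge2, ExteriorAlgebra.ιMulti_apply, add_mul])

theorem wedge2_add_right {V : Type} [AddCommGroup V] [Module ℂ V] (x y y' : V) :
    wedge2 x (y + y') = wedge2 x y + wedge2 x y' :=
  Subtype.ext (by simp [wedge2, ExteriorAlgebra.ιMulti_apply, mul_add])

/-- The map `c : H₂(Γ, ℂ) → Λ² H₁(Γ, ℂ)` dual to the cup product
(see `cupDual_isDual` below): the class of a 2-cycle `∑ zᵢ [gᵢ | hᵢ]` goes to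
`½ ∑ zᵢ [gᵢ] ∧ [hᵢ]`. -/
def cupDual (Γ : Type) [Group Γ] : hlg2 Γ →ₗ[ℂ] ⋀[ℂ]^2 (hlg1 Γ) :=
  descend (groupHomology.H2π (trivRep Γ)).hom (H2π_surjective Γ)
    (Finsupp.linearCombination ℂ (fun p : Γ × Γ => (1 / 2 : ℂ) • wedge2 (cls p.1) (cls p.2)) ∘ₗ
      (groupHomology.cycles₂ (trivRep Γ)).subtype) (by
      intro z hz
      obtain ⟨x, hx⟩ := (groupHomology.H2π_eq_zero_iff z).1 hz
      refine (congrArg _ hx.symm).trans (linearCombination_d₃₂ _ (fun g h j => ?_) x)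
      simp only [cls_mul, wedge2_add_left, wedge2_add_right, smul_add]
      abel)

theorem cupDual_H2π {Γ : Type} [Group Γ] (z : groupHomology.cycles₂ (trivRep Γ)) :
    cupDual Γ (groupHomology.H2π (trivRep Γ) z) =
      Finsupp.linearCombination ℂ
        (fun p : Γ × Γ => (1 / 2 : ℂ) • wedge2 (cls p.1) (cls p.2)) z.1 :=
  descend_apply _ (H2π_surjective Γ) _ _ z

/-! ### The cup product `H¹ × H¹ → H²`, the evaluation pairings, and the duality -/

/-- The morphism `Γ → ℂ` that a class in `H¹(Γ, ℂ)` is. -/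
def asHom {Γ : Type} [Group Γ] (α : cohlg1 Γ) (g : Γ) : ℂ :=
  ((groupCohomology.H1IsoOfIsTrivial (trivRep Γ)).hom α : Additive Γ →+ ℂ) (Additive.ofMul g)

theorem asHom_mul {Γ : Type} [Group Γ] (α : cohlg1 Γ) (g h : Γ) :
    asHom α (g * h) = asHom α g + asHom α h :=
  map_add ((groupCohomology.H1IsoOfIsTrivial (trivRep Γ)).hom α : Additive Γ →+ ℂ)
    (Additive.ofMul g) (Additive.ofMul h)

/-- The evaluation pairing of `H¹(Γ, ℂ)` with `H₁(Γ, ℂ)`: `α` and the class of `∑ zᵢ [gᵢ]`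
pair to `∑ zᵢ α(gᵢ)`. -/
def eval1 {Γ : Type} [Group Γ] (α : cohlg1 Γ) : Module.Dual ℂ (hlg1 Γ) :=
  descend (groupHomology.H1π (trivRep Γ)).hom (H1π_surjective Γ)
    (Finsupp.linearCombination ℂ (asHom α) ∘ₗ (groupHomology.cycles₁ (trivRep Γ)).subtype) (by
      intro z hz
      obtain ⟨x, hx⟩ := (groupHomology.H1π_eq_zero_iff z).1 hz
      refine (congrArg _ hx.symm).trans ((linearCombination_d₂₁ _ x).trans ?_)
      simp [asHom_mul, Finsupp.linearCombination_apply])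

theorem eval1_cls {Γ : Type} [Group Γ] (α : cohlg1 Γ) (g : Γ) : eval1 α (cls g) = asHom α g := by
  refine (descend_apply _ (H1π_surjective Γ) _ _ _).trans ?_
  refine (Finsupp.linearCombination_single ℂ (1 : ℂ) g).trans ?_
  simp

/-- The cup product `H¹(Γ, ℂ) × H¹(Γ, ℂ) → H²(Γ, ℂ)`: the class of the 2-cocycle
`(g, h) ↦ α(g) β(h)`. -/
def cup {Γ : Type} [Group Γ] (α β : cohlg1 Γ) : cohlg2 Γ :=
  groupCohomology.H2π (trivRep Γ)
    (⟨fun p : Γ × Γ => asHom α p.1 * asHom β p.2,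
      (groupCohomology.mem_cocycles₂_iff (A := trivRep Γ) _).2 fun g h j => by
        change asHom α (g * h) * asHom β j + asHom α g * asHom β h =
          asHom α h * asHom β j + asHom α g * asHom β (h * j)
        rw [asHom_mul, asHom_mul]; ring⟩ : groupCohomology.cocycles₂ (trivRep Γ))

/-- The evaluation pairing on the level of 2-cocycles. -/
def evalCocycle {Γ : Type} [Group Γ] (w : groupCohomology.cocycles₂ (trivRep Γ)) :
    Module.Dual ℂ (hlg2 Γ) :=
  descend (groupHomology.H2π (trivRep Γ)).hom (H2π_surjective Γ)
    (Finsupp.linearCombination ℂ (w.1 : Γ × Γ → ℂ) ∘ₗ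
      (groupHomology.cycles₂ (trivRep Γ)).subtype) (by
      intro z hz
      obtain ⟨x, hx⟩ := (groupHomology.H2π_eq_zero_iff z).1 hz
      refine (congrArg _ hx.symm).trans (linearCombination_d₃₂ _ (fun g h j => ?_) x)
      have h : (w.1 (g * h, j) + w.1 (g, h) : ℂ) = w.1 (h, j) + w.1 (g, h * j) :=
        (groupCohomology.mem_cocycles₂_iff (A := trivRep Γ) w.1).1 w.2 g h j
      linear_combination -h)

theorem evalCocycle_H2π {Γ : Type} [Group Γ] (w : groupCohomology.cocycles₂ (trivRep Γ))
    (z : groupHomology.cycles₂ (trivRep Γ)) :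
    evalCocycle w (groupHomology.H2π (trivRep Γ) z) =
      Finsupp.linearCombination ℂ (w.1 : Γ × Γ → ℂ) z.1 :=
  descend_apply _ (H2π_surjective Γ) _ _ z

/-- The evaluation pairing of `H²(Γ, ℂ)` with `H₂(Γ, ℂ)`: the class of a 2-cocycle `w` and the
class of `∑ zᵢ [gᵢ | hᵢ]` pair to `∑ zᵢ w(gᵢ, hᵢ)`. -/
def eval2 (Γ : Type) [Group Γ] : cohlg2 Γ →ₗ[ℂ] Module.Dual ℂ (hlg2 Γ) :=
  descend (groupCohomology.H2π (trivRep Γ)).hom (cohH2π_surjective Γ)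
    { toFun := evalCocycle
      map_add' := fun w w' => LinearMap.ext fun y => by
        induction y using groupHomology.H2_induction_on with
        | h z =>
          refine (evalCocycle_H2π _ z).trans ((?_ : _ = _ + _).trans
            (congrArg₂ (· + ·) (evalCocycle_H2π w z) (evalCocycle_H2π w' z)).symm)
          simp only [Finsupp.linearCombination_apply, ← Finsupp.sum_add]
          exact Finsupp.sum_congr fun p _ => mul_add (z.1 p : ℂ) (w.1 p : ℂ) (w'.1 p : ℂ)
      map_smul' := fun r w => LinearMap.ext fun y => by
        induction y using groupHomology.H2_induction_on with
        | h z =>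
          refine (evalCocycle_H2π _ z).trans ((?_ : _ = r * _).trans
            (congrArg (r * ·) (evalCocycle_H2π w z)).symm)
          simp only [Finsupp.linearCombination_apply, Finsupp.mul_sum]
          exact Finsupp.sum_congr fun p _ => mul_left_comm (z.1 p : ℂ) r (w.1 p : ℂ) }
    (by
      intro w hw
      obtain ⟨x, hx⟩ := (groupCohomology.H2π_eq_zero_iff w).1 hw
      refine LinearMap.ext fun y => ?_
      induction y using groupHomology.H2_induction_on with
      | h z =>
        refine (evalCocycle_H2π w z).trans ?_
        have e : (w.1 : Γ × Γ → ℂ) =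
            fun p => (x p.2 : ℂ) - (x (p.1 * p.2) : ℂ) + (x p.1 : ℂ) := hx.symm
        rw [e]
        refine (linearCombination_d₂₁ (M := ℂ) x z.1).symm.trans ?_
        exact (congrArg (Finsupp.linearCombination ℂ (x : Γ → ℂ)) z.2).trans (map_zero _))

theorem eval2_cup {Γ : Type} [Group Γ] (α β : cohlg1 Γ)
    (z : groupHomology.cycles₂ (trivRep Γ)) :
    eval2 Γ (cup α β) (groupHomology.H2π (trivRep Γ) z) =
      Finsupp.linearCombination ℂ (fun p : Γ × Γ => asHom α p.1 * asHom β p.2) z.1 :=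
  (LinearMap.congr_fun (descend_apply _ (cohH2π_surjective Γ) _ _ _) _).trans
    (evalCocycle_H2π _ z)

/-- `cupDual` is the dual of the cup product: `⟨α ∧ β, c(y)⟩ = ⟨α ∪ β, y⟩`. -/
theorem cupDual_isDual {Γ : Type} [Group Γ] (α β : cohlg1 Γ) (y : hlg2 Γ) :
    exteriorPower.pairingDual ℂ (hlg1 Γ) 2 (wedge2 (eval1 α) (eval1 β)) (cupDual Γ y) =
      eval2 Γ (cup α β) y := by
  induction y using groupHomology.H2_induction_on with
  | h z =>
    refine (congrArg _ (cupDual_H2π z)).trans ((?_ : _ = _).trans (eval2_cup α β z).symm)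
    have hz : Finsupp.linearCombination ℂ (fun p : Γ × Γ =>
        asHom α p.1 * asHom β p.2 + asHom α p.2 * asHom β p.1) z.1 = 0 := by
      have h0 := (linearCombination_d₂₁ (fun g : Γ => -(asHom α g * asHom β g)) z.1).symm.trans
        ((congrArg _ z.2).trans (map_zero _))
      refine Eq.trans ?_ h0
      congr 2
      funext p
      simp only [asHom_mul]
      ring
    have key : ∀ p : Γ × Γ, exteriorPower.pairingDual ℂ (hlg1 Γ) 2
        (wedge2 (eval1 α) (eval1 β)) ((1 / 2 : ℂ) • wedge2 (cls p.1) (cls p.2)) =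
        asHom α p.1 * asHom β p.2 -
          (1 / 2) * (asHom α p.1 * asHom β p.2 + asHom α p.2 * asHom β p.1) := fun p => by
      rw [map_smul, exteriorPower.pairingDual_ιMulti_ιMulti, Matrix.det_fin_two]
      simp [eval1_cls]
      ring
    rw [Finsupp.apply_linearCombination]
    have e : ((exteriorPower.pairingDual ℂ (hlg1 Γ) 2 (wedge2 (eval1 α) (eval1 β))) ∘
        fun p : Γ × Γ => (1 / 2 : ℂ) • wedge2 (cls p.1) (cls p.2)) = _ := funext key
    rw [e]
    rw [Finsupp.linearCombination_apply] at hz ⊢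
    have h2 := congrArg (fun t : ℂ => (1 / 2) * t) hz
    simp only [Finsupp.mul_sum, mul_zero] at h2
    rw [Finsupp.linearCombination_apply]
    refine sub_eq_zero.1 ?_
    rw [← Finsupp.sum_sub, ← neg_eq_zero, ← h2, ← Finsupp.sum_neg]
    refine Finsupp.sum_congr fun p _ => ?_
    simp only [smul_eq_mul]
    ring

/-! ### The space `𝓔(Γ)` -/

/-- The product `V × Λ² V → Λ³ V`, `(x, w) ↦ x ∧ w`. -/
def wedge {V : Type} [AddCommGroup V] [Module ℂ V] (x : V) (w : ⋀[ℂ]^2 V) : ⋀[ℂ]^3 V :=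
  ⟨ExteriorAlgebra.ι ℂ x * (w : ExteriorAlgebra ℂ V), by
    have h := Submodule.mul_mem_mul (LinearMap.mem_range_self (ExteriorAlgebra.ι ℂ) x) w.2
    rwa [← pow_succ'] at h⟩

/-- `𝓔(Γ)`: the linear forms `Φ` on `Λ³ H₁(Γ, ℂ)` with `Φ(x ∧ c(y)) = 0` for all
`x ∈ H₁(Γ, ℂ)` and `y ∈ H₂(Γ, ℂ)`. -/
def cubicForms (Γ : Type) [Group Γ] : Submodule ℂ (Module.Dual ℂ (⋀[ℂ]^3 (hlg1 Γ))) where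
  carrier := {Φ | ∀ (x : hlg1 Γ) (y : hlg2 Γ), Φ (wedge x (cupDual Γ y)) = 0}
  zero_mem' := fun _ _ => rfl
  add_mem' := by
    intro Φ Ψ hΦ hΨ x y
    rw [LinearMap.add_apply, hΦ x y, hΨ x y, add_zero]
  smul_mem' := by
    intro r Φ hΦ x y
    rw [LinearMap.smul_apply, hΦ x y, smul_zero]

end Parallelogram

end

/-! Let `T(x, y, z) = f((x - 1)(y - 1)(z - 1))` for a parallelogram function `f`. Such an `f` is
even and central, so `T` is cyclically invariant; evenness and the parallelogram law make it change
sign under each transposition. The fourth difference of `f` is cyclically invariant for the same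
reason and antisymmetric in its arguments; a 4-cycle is odd, so it vanishes (`linearize_eps3_mul`).
Thus `T` is an alternating trimorphism and descends to `Λ³ H₁`.

Kernel: `T = 0` says that the polarization of `f` is a bimorphism, and `f` is half its diagonal.

Image: for fixed `γ`, `T(γ, g, h)` is up to sign the coboundary of the polarization `f(γ g) - f(γ) -
f(g)`, so it vanishes on 2-cycles, which is membership in `𝓔(Γ)`. Conversely, if `φ(γ, g, h) = Φ([γ]
∧ [g] ∧ [h])` vanishes on 2-cycles, it has a primitive `B(γ, g)` additive in `γ`
(`exists_primitive`), and `x ↦ B(x, x)` is a preimage of `Φ` (`exists_eps3Dual_eq`). -/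

noncomputable section

namespace Parallelogram

/-! ### The universal property of `H₁(Γ, ℂ)` -/

section UniversalProperty

variable {Γ M : Type} [Group Γ] [AddCommGroup M] [Module ℂ M]

/-- The linear map `H₁(Γ, ℂ) → M` induced by a morphism `Γ → M`. -/
def liftHom (F : Γ → M) (hF : ∀ g h, F (g * h) = F g + F h) : hlg1 Γ →ₗ[ℂ] M :=
  descend (groupHomology.H1π (trivRep Γ)).hom (H1π_surjective Γ)
    (Finsupp.linearCombination ℂ F ∘ₗ (groupHomology.cycles₁ (trivRep Γ)).subtype) (by
      intro z hz
      obtain ⟨x, hx⟩ := (groupHomology.H1π_eq_zero_iff z).1 hz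
      refine (congrArg _ hx.symm).trans ((linearCombination_d₂₁ _ x).trans ?_)
      simp [hF, Finsupp.linearCombination_apply])

theorem liftHom_cls (F : Γ → M) (hF : ∀ g h, F (g * h) = F g + F h) (g : Γ) :
    liftHom F hF (cls g) = F g := by
  refine (descend_apply _ (H1π_surjective Γ) _ _ _).trans ?_
  refine (Finsupp.linearCombination_single ℂ (1 : ℂ) g).trans ?_
  simp

/-- With trivial coefficients every 1-chain is a cycle, so the classes of group elements span `H₁`.
-/
theorem hlg1_hom_ext {L L' : hlg1 Γ →ₗ[ℂ] M} (h : ∀ g, L (cls g) = L' (cls g)) : L = L' := by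
  have key : L ∘ₗ (groupHomology.H1π (trivRep Γ)).hom ∘ₗ
        (groupHomology.cycles₁IsoOfIsTrivial (trivRep Γ)).inv.hom =
      L' ∘ₗ (groupHomology.H1π (trivRep Γ)).hom ∘ₗ
        (groupHomology.cycles₁IsoOfIsTrivial (trivRep Γ)).inv.hom := by
    refine Finsupp.lhom_ext' fun g => LinearMap.ext_ring ?_
    exact h g
  refine LinearMap.ext fun y => ?_
  obtain ⟨z, rfl⟩ := H1π_surjective Γ y
  have := LinearMap.congr_fun key ((groupHomology.cycles₁IsoOfIsTrivial (trivRep Γ)).hom z)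
  simpa using this

theorem cls_one : cls (1 : Γ) = 0 := by
  have := cls_mul (1 : Γ) 1
  rw [mul_one] at this
  exact left_eq_add.1 this

theorem cls_inv (g : Γ) : cls g⁻¹ = -cls g := by
  rw [eq_neg_iff_add_eq_zero, ← cls_mul, inv_mul_cancel, cls_one]

/-- Peels off one argument at a time, so that `hlg1_hom_ext` applies to each in turn. -/
theorem alternatingMap_curryLeft_injective {V : Type} [AddCommGroup V] [Module ℂ V] {n : ℕ}
    {A B : V [⋀^Fin (n + 1)]→ₗ[ℂ] M} (h : ∀ x, A.curryLeft x = B.curryLeft x) : A = B :=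
  AlternatingMap.ext fun v => by
    rw [← Matrix.cons_head_tail v]
    exact congrArg (fun L => L (Matrix.vecTail v)) (h (Matrix.vecHead v))

theorem hlg1_alternating_ext {A B : hlg1 Γ [⋀^Fin 3]→ₗ[ℂ] M}
    (h : ∀ x y z, A ![cls x, cls y, cls z] = B ![cls x, cls y, cls z]) : A = B := by
  refine alternatingMap_curryLeft_injective (LinearMap.congr_fun (hlg1_hom_ext fun x => ?_))
  refine alternatingMap_curryLeft_injective (LinearMap.congr_fun (hlg1_hom_ext fun y => ?_))
  refine alternatingMap_curryLeft_injective (LinearMap.congr_fun (hlg1_hom_ext fun z => ?_))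
  refine AlternatingMap.ext fun v => ?_
  rw [Subsingleton.elim v ![]]
  exact h x y z

theorem hlg1_exteriorPower_ext {Φ Ψ : ⋀[ℂ]^3 (hlg1 Γ) →ₗ[ℂ] M}
    (h : ∀ x y z, Φ (exteriorPower.ιMulti ℂ 3 ![cls x, cls y, cls z]) =
      Ψ (exteriorPower.ιMulti ℂ 3 ![cls x, cls y, cls z])) : Φ = Ψ :=
  exteriorPower.linearMap_ext (hlg1_alternating_ext h)

/-- The linear map `Λ³ H₁(Γ, ℂ) → M` induced by an alternating trimorphism on `Γ`. -/
theorem exists_exteriorPower_lift (ψ : Γ → Γ → Γ → M)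
    (h1 : ∀ x x' y z, ψ (x * x') y z = ψ x y z + ψ x' y z)
    (h12 : ∀ x y z, ψ y x z = -ψ x y z) (h23 : ∀ x y z, ψ x z y = -ψ x y z) :
    ∃ Φ : ⋀[ℂ]^3 (hlg1 Γ) →ₗ[ℂ] M, ∀ x y z,
      Φ (exteriorPower.ιMulti ℂ 3 ![cls x, cls y, cls z]) = ψ x y z := by
  have h2 : ∀ x y y' z, ψ x (y * y') z = ψ x y z + ψ x y' z := fun x y y' z => by
    rw [h12 (y * y'), h1, neg_add, ← h12, ← h12]
  have h3 : ∀ x y z z', ψ x y (z * z') = ψ x y z + ψ x y z' := fun x y z z' => by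
    rw [h23 x (z * z'), h2, neg_add, ← h23, ← h23]
  let T : hlg1 Γ →ₗ[ℂ] hlg1 Γ →ₗ[ℂ] hlg1 Γ →ₗ[ℂ] M :=
    liftHom (fun x => liftHom (fun y => liftHom (ψ x y) (h3 x y))
      fun y y' => hlg1_hom_ext fun z => by
        simp only [LinearMap.add_apply, liftHom_cls, h2])
      fun x x' => hlg1_hom_ext fun y => hlg1_hom_ext fun z => by
        simp only [LinearMap.add_apply, liftHom_cls, h1]
  have hT : ∀ x y z, T (cls x) (cls y) (cls z) = ψ x y z := fun x y z => by
    simp only [T, liftHom_cls]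
  have t12 : ∀ x y z, T y x z = -T x y z := fun x y z => by
    have : T.flip = -T := by
      refine hlg1_hom_ext fun x => hlg1_hom_ext fun y => hlg1_hom_ext fun z => ?_
      simp only [LinearMap.flip_apply, LinearMap.neg_apply, hT]
      exact h12 x y z
    simpa using congrArg (fun L => L x y z) this
  have t23 : ∀ x y z, T x z y = -T x y z := fun x y z => by
    have : LinearMap.lflip.toLinearMap ∘ₗ T = -T := by
      refine hlg1_hom_ext fun x => hlg1_hom_ext fun y => hlg1_hom_ext fun z => ?_
      simp only [LinearMap.comp_apply, LinearEquiv.coe_coe, LinearMap.lflip_apply,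
        LinearMap.flip_apply, LinearMap.neg_apply, hT]
      exact h23 x y z
    exact congrArg (fun L => L x y z) this
  -- Over `ℂ`, antisymmetric forms are alternating.
  have hneg : ∀ m : M, m = -m → m = 0 := fun m hm => by
    have : (2 : ℂ) • m = 0 := by rw [two_smul]; nth_rw 1 [hm]; simp
    simpa using this
  have z12 : ∀ x z, T x x z = 0 := fun x z => hneg _ (t12 x x z)
  have z23 : ∀ x z, T x z z = 0 := fun x z => hneg _ (t23 x z z)
  have z13 : ∀ x z, T x z x = 0 := fun x z => by rw [t12, z23, neg_zero]
  let A : hlg1 Γ [⋀^Fin 3]→ₗ[ℂ] M :=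
    { toFun := fun v => T (v 0) (v 1) (v 2)
      map_update_add' := by
        intro inst v i a b
        obtain rfl : inst = instDecidableEqFin 3 := Subsingleton.elim _ _
        fin_cases i <;> simp
      map_update_smul' := by
        intro inst v i a b
        obtain rfl : inst = instDecidableEqFin 3 := Subsingleton.elim _ _
        fin_cases i <;> simp
      map_eq_zero_of_eq' := fun v i j hv hij => by
        fin_cases i <;> fin_cases j <;> first | exact absurd rfl hij | skip
        all_goals simp only [Fin.zero_eta, Fin.mk_one, Fin.reduceFinMk] at hv
        all_goals simp only [hv, z12, z13, z23] }
  refine ⟨exteriorPower.alternatingMapLinearEquiv A, fun x y z => ?_⟩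
  rw [exteriorPower.alternatingMapLinearEquiv_apply_ιMulti]
  exact hT x y z

end UniversalProperty

/-! ### The product `V × Λ² V → Λ³ V` -/

/-- `wedge` as a bilinear map. -/
def wedgeₗ (V : Type) [AddCommGroup V] [Module ℂ V] : V →ₗ[ℂ] ⋀[ℂ]^2 V →ₗ[ℂ] ⋀[ℂ]^3 V :=
  LinearMap.mk₂ ℂ wedge
    (fun x x' w => Subtype.ext (by simp [wedge, add_mul]))
    (fun r x w => Subtype.ext (by simp [wedge]))
    (fun x w w' => Subtype.ext (by simp [wedge, mul_add]))
    (fun r x w => Subtype.ext (by simp [wedge]))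

theorem wedgeₗ_wedge2 {V : Type} [AddCommGroup V] [Module ℂ V] (x y z : V) :
    wedgeₗ V x (wedge2 y z) = exteriorPower.ιMulti ℂ 3 ![x, y, z] :=
  Subtype.ext (by simp [wedgeₗ, wedge, wedge2, ExteriorAlgebra.ιMulti_apply])

/-- `Φ` lies in `𝓔(Γ)` if and only if the cochains `(g, h) ↦ Φ([γ] ∧ [g] ∧ [h])` vanish on
2-cycles. -/
theorem mem_cubicForms_iff {Γ : Type} [Group Γ] (Φ : Module.Dual ℂ (⋀[ℂ]^3 (hlg1 Γ))) :
    Φ ∈ cubicForms Γ ↔ ∀ (γ : Γ) (z : groupHomology.cycles₂ (trivRep Γ)),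
      Finsupp.linearCombination ℂ (fun p : Γ × Γ =>
        Φ (exteriorPower.ιMulti ℂ 3 ![cls γ, cls p.1, cls p.2])) z.1 = 0 := by
  have key : ∀ (γ : Γ) (z : groupHomology.cycles₂ (trivRep Γ)),
      Φ (wedge (cls γ) (cupDual Γ (groupHomology.H2π (trivRep Γ) z))) =
      (1 / 2 : ℂ) * Finsupp.linearCombination ℂ (fun p : Γ × Γ =>
        Φ (exteriorPower.ιMulti ℂ 3 ![cls γ, cls p.1, cls p.2])) z.1 := fun γ z => by
    change (Φ ∘ₗ wedgeₗ _ (cls γ)) _ = _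
    rw [cupDual_H2π, Finsupp.apply_linearCombination, Finsupp.linearCombination_apply,
      Finsupp.linearCombination_apply, Finsupp.mul_sum]
    refine Finsupp.sum_congr fun p _ => ?_
    simp only [Function.comp_apply, map_smul, LinearMap.comp_apply, wedgeₗ_wedge2, smul_eq_mul]
    ring
  constructor
  · intro h γ z
    have := key γ z
    rw [h] at this
    simpa using this.symm
  · intro h x y
    induction y using groupHomology.H2_induction_on with
    | h z =>
      -- For a fixed cycle the condition is linear in `x`, so classes of group elements suffice.
      have : Φ ∘ₗ (wedgeₗ (hlg1 Γ)).flip (cupDual Γ (groupHomology.H2π (trivRep Γ) z)) = 0 :=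
        hlg1_hom_ext fun γ => (key γ z).trans (by rw [h, mul_zero]; rfl)
      exact LinearMap.congr_fun this x

/-! ### Parallelogram functions -/

theorem linearize_add_apply {Γ : Type} (f g : Γ → ℂ) (a : MonoidAlgebra ℂ Γ) :
    linearize (f + g) a = linearize f a + linearize g a := by
  simp [linearize, Finsupp.linearCombination_apply, mul_add, Finsupp.sum_add]

theorem linearize_smul_apply {Γ : Type} (r : ℂ) (f : Γ → ℂ) (a : MonoidAlgebra ℂ Γ) :
    linearize (r • f) a = r * linearize f a := by
  simp [linearize, Finsupp.linearCombination_apply, Finsupp.mul_sum, mul_left_comm]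

section Functions

variable {Γ : Type} [Group Γ]

/-- The polarization `f(xy) - f(x) - f(y)`. -/
def polar (f : Γ → ℂ) (x y : Γ) : ℂ := f (x * y) - f x - f y

theorem linearize_of (f : Γ → ℂ) (g : Γ) : linearize f (MonoidAlgebra.of ℂ Γ g) = f g := by
  simp [linearize]

theorem linearize_eps3 (f : Γ → ℂ) (h1 : f 1 = 0) (x y z : Γ) :
    linearize f (eps3 x y z) = f (x * y * z) - f (x * y) - f (x * z) - f (y * z)
      + f x + f y + f z := by
  have e : eps3 x y z = MonoidAlgebra.of ℂ Γ (x * y * z) - MonoidAlgebra.of ℂ Γ (x * y)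
      - MonoidAlgebra.of ℂ Γ (x * z) - MonoidAlgebra.of ℂ Γ (y * z) + MonoidAlgebra.of ℂ Γ x
      + MonoidAlgebra.of ℂ Γ y + MonoidAlgebra.of ℂ Γ z - MonoidAlgebra.of ℂ Γ 1 := by
    simp only [eps3, map_mul, map_one]
    noncomm_ring
  rw [e]
  simp only [map_add, map_sub, linearize_of, h1, sub_zero]

theorem linearize_eps3_eq_polar (f : Γ → ℂ) (h1 : f 1 = 0) (x y z : Γ) :
    linearize f (eps3 x y z) = polar f (x * y) z - polar f x z - polar f y z := by
  rw [linearize_eps3 f h1]; simp only [polar]; ring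

/-- For fixed `x` this exhibits the third difference, up to sign, as a coboundary in `(y, z)`. -/
theorem linearize_eps3_eq_polar' (f : Γ → ℂ) (h1 : f 1 = 0) (x y z : Γ) :
    linearize f (eps3 x y z) = polar f x (y * z) - polar f x y - polar f x z := by
  rw [linearize_eps3 f h1]; simp only [polar, mul_assoc]; ring

namespace parallelogramFunctions

variable {f : Γ → ℂ}

theorem map_one (hf : f ∈ parallelogramFunctions Γ) : f 1 = 0 := by
  have := hf 1 1
  simp only [inv_one, mul_one] at this
  linear_combination -this / 2

theorem map_inv (hf : f ∈ parallelogramFunctions Γ) (x : Γ) : f x⁻¹ = f x := by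
  have := hf 1 x
  simp only [one_mul, map_one hf] at this
  linear_combination this

/-- Exchanging `x` and `y` in the parallelogram law changes only `f(xy)` and `f(xy⁻¹)`; the latter
is unaffected because `yx⁻¹` is the inverse of `xy⁻¹`. -/
theorem map_mul_comm (hf : f ∈ parallelogramFunctions Γ) (x y : Γ) : f (x * y) = f (y * x) := by
  have h1 := hf x y
  have h2 := hf y x
  have h3 := map_inv hf (x * y⁻¹)
  rw [mul_inv_rev, inv_inv] at h3
  linear_combination h1 - h2 + h3

theorem linearize_eps3_cyclic (hf : f ∈ parallelogramFunctions Γ)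
    (x y z : Γ) :
    linearize f (eps3 y z x) = linearize f (eps3 x y z) := by
  have h1 := map_one hf
  rw [linearize_eps3 f h1, linearize_eps3 f h1, map_mul_comm hf (y * z) x, map_mul_comm hf y x,
    map_mul_comm hf z x, mul_assoc]
  ring

/-- The sum of both sides' differences is controlled by the parallelogram law at `(xy, z)`, `(x, z)`
and `(y, z)`. -/
theorem linearize_eps3_inv (hf : f ∈ parallelogramFunctions Γ)
    (x y z : Γ) :
    linearize f (eps3 x y z⁻¹) = -linearize f (eps3 x y z) := by
  have h1 := map_one hf
  rw [linearize_eps3 f h1, linearize_eps3 f h1]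
  linear_combination hf (x * y) z - hf x z - hf y z + map_inv hf z

/-- Inversion reverses products and preserves `f`. Undoing the three inverses, each rotated into the
last slot, costs three signs. -/
theorem linearize_eps3_reverse (hf : f ∈ parallelogramFunctions Γ)
    (x y z : Γ) :
    linearize f (eps3 z y x) = -linearize f (eps3 x y z) := by
  have h1 := map_one hf
  have h : linearize f (eps3 z⁻¹ y⁻¹ x⁻¹) = linearize f (eps3 x y z) := by
    rw [linearize_eps3 f h1, linearize_eps3 f h1]
    simp only [← mul_inv_rev, map_inv hf, mul_assoc]
    ring
  rw [← h, linearize_eps3_inv hf, linearize_eps3_cyclic hf x z⁻¹ y⁻¹, linearize_eps3_inv hf,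
    linearize_eps3_cyclic hf y x z⁻¹, linearize_eps3_inv hf, linearize_eps3_cyclic hf z y x]
  ring

theorem linearize_eps3_swap_left (hf : f ∈ parallelogramFunctions Γ)
    (x y z : Γ) :
    linearize f (eps3 y x z) = -linearize f (eps3 x y z) := by
  rw [← linearize_eps3_reverse hf, linearize_eps3_cyclic hf z y x]

theorem linearize_eps3_swap_right (hf : f ∈ parallelogramFunctions Γ)
    (x y z : Γ) :
    linearize f (eps3 x z y) = -linearize f (eps3 x y z) := by
  rw [← linearize_eps3_reverse hf, linearize_eps3_cyclic hf x z y]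

/-- The fourth difference `f((x - 1)(y - 1)(z - 1)(w - 1))` is both invariant and antiinvariant
under the cyclic rotation of its arguments, hence vanishes. -/
theorem linearize_eps3_mul (hf : f ∈ parallelogramFunctions Γ)
    (x x' y z : Γ) :
    linearize f (eps3 (x * x') y z) = linearize f (eps3 x y z) + linearize f (eps3 x' y z) := by
  have h1 := map_one hf
  -- This is the fourth difference, as `(xy - 1) - (x - 1) - (y - 1) = (x - 1)(y - 1)`.
  let D : Γ → Γ → Γ → Γ → ℂ := fun x y z w => linearize f (eps3 (x * y) z w) -
    linearize f (eps3 x z w) - linearize f (eps3 y z w)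
  have swap : ∀ x y z w, D x y w z = -D x y z w := fun x y z w => by
    simp only [D, linearize_eps3_swap_right hf (x * y) z w, linearize_eps3_swap_right hf x z w,
      linearize_eps3_swap_right hf y z w]
    ring
  have cyc : ∀ x y z w, D y z w x = D x y z w := fun x y z w => by
    simp only [D, linearize_eps3 f h1]
    rw [map_mul_comm hf (y * z * w) x, map_mul_comm hf (y * z) x, map_mul_comm hf (y * w) x,
      map_mul_comm hf (z * w) x, map_mul_comm hf y x, map_mul_comm hf z x, map_mul_comm hf w x]
    simp only [mul_assoc]
    ring
  have swap₂₃ : ∀ x y z w, D x z y w = -D x y z w := fun x y z w => by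
    rw [cyc w x z y, swap, cyc w x y z]
  have swap₁₂ : ∀ x y z w, D y x z w = -D x y z w := fun x y z w => by
    rw [cyc w y x z, swap₂₃, cyc w x y z]
  have h : D x x' y z = 0 := by
    -- The rotation is a product of three adjacent transpositions, hence `D = -D`.
    have e := cyc x x' y z
    rw [swap, swap₂₃, swap₁₂, neg_neg] at e
    linear_combination -e / 2
  linear_combination h

theorem mem_quadraticForms (hf : f ∈ parallelogramFunctions Γ)
    (h : ∀ x y z, linearize f (eps3 x y z) = 0) : f ∈ quadraticForms Γ := by
  have h1 := map_one hf
  refine ⟨fun x y => polar f x y / 2, ⟨fun x y z => ?_, fun x y z => ?_⟩, fun x => ?_⟩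
  · linear_combination (linearize_eps3_eq_polar f h1 x y z).symm.trans (h x y z) / 2
  · linear_combination (linearize_eps3_eq_polar' f h1 x y z).symm.trans (h x y z) / 2
  -- The parallelogram law at `(x, x)` gives `f(x²) = 4 f(x)`, which explains the factor `1/2`.
  · have := hf x x
    rw [mul_inv_cancel, h1] at this
    simp only [polar]
    linear_combination -this / 2

end parallelogramFunctions

theorem linearize_eps3_of_mem_quadraticForms {f : Γ → ℂ} (hf : f ∈ quadraticForms Γ)
    (x y z : Γ) : linearize f (eps3 x y z) = 0 := by
  rw [linearize_eps3 f (parallelogramFunctions.map_one (quadraticForms_le Γ hf))]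
  obtain ⟨b, ⟨h1, h2⟩, hb⟩ := hf
  simp only [hb, h1, h2]
  ring

/-! ### The map `ε₃*` -/

theorem exists_eps3Dual (f : parallelogramFunctions Γ) :
    ∃ Φ : Module.Dual ℂ (⋀[ℂ]^3 (hlg1 Γ)), ∀ x y z,
      Φ (exteriorPower.ιMulti ℂ 3 ![cls x, cls y, cls z]) = linearize (f : Γ → ℂ) (eps3 x y z) :=
  exists_exteriorPower_lift _ (parallelogramFunctions.linearize_eps3_mul f.2)
    (parallelogramFunctions.linearize_eps3_swap_left f.2)
    (parallelogramFunctions.linearize_eps3_swap_right f.2)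

/-- The map `ε₃* : 𝒫(Γ) → (Λ³ H₁(Γ, ℂ))*`, `f ↦ f ∘ ε₃`. -/
def eps3Dual (Γ : Type) [Group Γ] :
    parallelogramFunctions Γ →ₗ[ℂ] Module.Dual ℂ (⋀[ℂ]^3 (hlg1 Γ)) where
  toFun f := (exists_eps3Dual f).choose
  map_add' f g := hlg1_exteriorPower_ext fun x y z => by
    rw [LinearMap.add_apply, (exists_eps3Dual _).choose_spec, (exists_eps3Dual _).choose_spec,
      (exists_eps3Dual _).choose_spec]
    exact linearize_add_apply _ _ _
  map_smul' r f := hlg1_exteriorPower_ext fun x y z => by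
    rw [LinearMap.smul_apply, (exists_eps3Dual _).choose_spec, (exists_eps3Dual _).choose_spec]
    exact linearize_smul_apply _ _ _

theorem eps3Dual_ιMulti (f : parallelogramFunctions Γ) (x y z : Γ) :
    eps3Dual Γ f (exteriorPower.ιMulti ℂ 3 ![cls x, cls y, cls z]) =
      linearize (f : Γ → ℂ) (eps3 x y z) :=
  (exists_eps3Dual f).choose_spec x y z

theorem eps3Dual_eq_zero_iff (f : parallelogramFunctions Γ) :
    eps3Dual Γ f = 0 ↔ (f : Γ → ℂ) ∈ quadraticForms Γ := by
  refine ⟨fun h => parallelogramFunctions.mem_quadraticForms f.2 fun x y z => ?_,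
    fun h => hlg1_exteriorPower_ext fun x y z => ?_⟩
  · rw [← eps3Dual_ιMulti, h, LinearMap.zero_apply]
  · rw [eps3Dual_ιMulti, linearize_eps3_of_mem_quadraticForms h, LinearMap.zero_apply]

theorem eps3Dual_mem_cubicForms (f : parallelogramFunctions Γ) :
    eps3Dual Γ f ∈ cubicForms Γ := by
  refine (mem_cubicForms_iff _).2 fun γ z => ?_
  have h0 := (linearCombination_d₂₁ (fun g : Γ => -polar (f : Γ → ℂ) γ g) z.1).symm.trans
    ((congrArg _ z.2).trans (map_zero _))
  refine Eq.trans ?_ h0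
  congr 2
  funext p
  rw [eps3Dual_ιMulti, linearize_eps3_eq_polar' _ (parallelogramFunctions.map_one f.2)]
  ring

/-! ### Surjectivity onto `𝓔(Γ)` -/

/-- Every linear map between vector spaces has a generalized inverse. -/
theorem exists_generalizedInverse {V W : Type} [AddCommGroup V] [Module ℂ V] [AddCommGroup W]
    [Module ℂ W] (d : V →ₗ[ℂ] W) : ∃ t : W →ₗ[ℂ] V, ∀ w, d (t (d w)) = d w := by
  obtain ⟨s, hs⟩ := d.rangeRestrict.exists_rightInverse_of_surjective d.range_rangeRestrict
  obtain ⟨t, ht⟩ := LinearMap.exists_extend s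
  refine ⟨t, fun w => ?_⟩
  have e : t (d w) = s (d.rangeRestrict w) := LinearMap.congr_fun ht (d.rangeRestrict w)
  rw [e]
  exact congrArg Subtype.val (LinearMap.congr_fun hs (d.rangeRestrict w))

/-- If the cocycles `(g, h) ↦ Φ([γ] ∧ [g] ∧ [h])` vanish on 2-cycles, they are the coboundaries of
cochains that depend on `γ` additively. -/
theorem exists_primitive {Φ : Module.Dual ℂ (⋀[ℂ]^3 (hlg1 Γ))} (hΦ : Φ ∈ cubicForms Γ) :
    ∃ B : Γ → Γ → ℂ, (∀ x x' y, B (x * x') y = B x y + B x' y) ∧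
      ∀ x y z, B x (y * z) = B x y + B x z +
        Φ (exteriorPower.ιMulti ℂ 3 ![cls x, cls y, cls z]) := by
  rw [mem_cubicForms_iff] at hΦ
  let d : (Γ × Γ →₀ ℂ) →ₗ[ℂ] (Γ →₀ ℂ) := (groupHomology.d₂₁ (trivRep Γ)).hom
  let L : Γ → (Γ × Γ →₀ ℂ) →ₗ[ℂ] ℂ := fun γ => Finsupp.linearCombination ℂ fun p : Γ × Γ =>
    Φ (exteriorPower.ιMulti ℂ 3 ![cls γ, cls p.1, cls p.2])
  have hL : ∀ γ w, d w = 0 → L γ w = 0 := fun γ w hw => hΦ γ ⟨w, hw⟩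
  have hLs : ∀ γ p, L γ (Finsupp.single p 1) =
      Φ (exteriorPower.ιMulti ℂ 3 ![cls γ, cls p.1, cls p.2]) := fun γ p => by simp [L]
  have hLadd : ∀ x x', L (x * x') = L x + L x' := fun x x' => by
    refine Finsupp.lhom_ext' fun p => LinearMap.ext_ring ?_
    simp only [LinearMap.comp_apply, Finsupp.lsingle_apply, LinearMap.add_apply, hLs, cls_mul,
      ← wedgeₗ_wedge2, map_add]
  -- A single `t` serves all `γ`; this keeps the primitive additive in `γ`.
  obtain ⟨t, ht⟩ := exists_generalizedInverse d
  -- `t (d w) - w` is a cycle, on which `L γ` vanishes.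
  have hLd : ∀ γ w, L γ (t (d w)) = L γ w := fun γ w =>
    sub_eq_zero.1 (by rw [← map_sub]; exact hL _ _ (by rw [map_sub, ht, sub_self]))
  refine ⟨fun x y => -L x (t (Finsupp.single y 1)), fun x x' y => ?_, fun x y z => ?_⟩
  · simp only [hLadd, LinearMap.add_apply]; ring
  · have h := hLd x (Finsupp.single (y, z) 1)
    have e : d (Finsupp.single (y, z) 1) =
        Finsupp.single z 1 - Finsupp.single (y * z) 1 + Finsupp.single y 1 :=
      groupHomology.d₂₁_single (A := trivRep Γ) (y, z) (1 : ℂ)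
    rw [e, hLs] at h
    simp only [map_add, map_sub] at h
    linear_combination h

theorem exists_eps3Dual_eq {Φ : Module.Dual ℂ (⋀[ℂ]^3 (hlg1 Γ))} (hΦ : Φ ∈ cubicForms Γ) :
    ∃ f, eps3Dual Γ f = Φ := by
  obtain ⟨B, hB1, hB2⟩ := exists_primitive hΦ
  let φ : Γ → Γ → Γ → ℂ := fun x y z => Φ (exteriorPower.ιMulti ℂ 3 ![cls x, cls y, cls z])
  replace hB2 : ∀ x y z, B x (y * z) = B x y + B x z + φ x y z := hB2
  have eq_zero : ∀ v : Fin 3 → hlg1 Γ, (∃ i j, i ≠ j ∧ v i = v j) →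
      Φ (exteriorPower.ιMulti ℂ 3 v) = 0 := fun v ⟨i, j, hij, hv⟩ => by
    rw [AlternatingMap.map_eq_zero_of_eq _ v hv hij, map_zero]
  have φ12 : ∀ x y, φ x x y = 0 := fun x y => eq_zero _ ⟨0, 1, by decide, rfl⟩
  have φ23 : ∀ x y, φ x y y = 0 := fun x y => eq_zero _ ⟨1, 2, by decide, rfl⟩
  have φ13 : ∀ x y, φ x y x = 0 := fun x y => eq_zero _ ⟨0, 2, by decide, rfl⟩
  have φ_inv : ∀ x y, φ x y y⁻¹ = 0 := fun x y => by
    have : wedge2 (cls y) (cls y⁻¹) = -wedge2 (cls y) (cls y) := by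
      rw [eq_neg_iff_add_eq_zero, ← wedge2_add_right, cls_inv, neg_add_cancel]
      exact AlternatingMap.map_coord_zero _ 1 rfl
    have h := φ23 x y
    simp only [φ, ← wedgeₗ_wedge2] at h ⊢
    rw [this, map_neg, map_neg, h, neg_zero]
  have φ_cyc : ∀ x y z, φ z x y = φ x y z := fun x y z => by
    have a : ∀ x y z, φ y x z = -φ x y z := fun x y z => by
      have h := AlternatingMap.map_swap (exteriorPower.ιMulti ℂ 3) ![cls x, cls y, cls z]
        (show (0 : Fin 3) ≠ 1 by decide)
      have e : ![cls x, cls y, cls z] ∘ Equiv.swap (0 : Fin 3) 1 = ![cls y, cls x, cls z] := by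
        funext i; fin_cases i <;> rfl
      rw [e] at h
      simp only [φ, h, map_neg]
    have b : ∀ x y z, φ x z y = -φ x y z := fun x y z => by
      have h := AlternatingMap.map_swap (exteriorPower.ιMulti ℂ 3) ![cls x, cls y, cls z]
        (show (1 : Fin 3) ≠ 2 by decide)
      have e : ![cls x, cls y, cls z] ∘ Equiv.swap (1 : Fin 3) 2 = ![cls x, cls z, cls y] := by
        funext i; fin_cases i <;> rfl
      rw [e] at h
      simp only [φ, h, map_neg]
    rw [a x z y, b x y z, neg_neg]
  have B_one_right : ∀ x, B x 1 = 0 := fun x => by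
    have h := hB2 x 1 1
    rw [mul_one, φ23] at h
    linear_combination -h
  have B_one_left : ∀ y, B 1 y = 0 := fun y => by
    have h := hB1 1 1 y
    rw [mul_one] at h
    linear_combination -h
  have B_inv_right : ∀ x y, B x y⁻¹ = -B x y := fun x y => by
    have h := hB2 x y y⁻¹
    rw [mul_inv_cancel, B_one_right, φ_inv] at h
    linear_combination -h
  have B_inv_left : ∀ x y, B x⁻¹ y = -B x y := fun x y => by
    have h := hB1 x x⁻¹ y
    rw [mul_inv_cancel, B_one_left] at h
    linear_combination -h
  -- The `φ` terms have a repeated argument, so `B` behaves like a bimorphism on the diagonal.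
  have hdiag : ∀ x y, B (x * y) (x * y) = B x x + B y y + B x y + B y x := fun x y => by
    rw [hB1, hB2, hB2, φ12, φ13]; ring
  have hf : (fun x => B x x) ∈ parallelogramFunctions Γ := fun x y => by
    simp only [hdiag, B_inv_left, B_inv_right]
    ring
  refine ⟨⟨fun x => B x x, hf⟩, hlg1_exteriorPower_ext fun x y z => ?_⟩
  rw [eps3Dual_ιMulti, linearize_eps3_eq_polar _ (parallelogramFunctions.map_one hf)]
  change _ = φ x y z
  -- Only `B z (x * y)` fails to be additive; its defect `φ z x y` is a rotation of `φ x y z`.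
  simp only [polar, hdiag, hB1, hB2]
  linear_combination φ_cyc x y z

end Functions

end Parallelogram

end

open Parallelogram in
/-- The sequence `0 → 𝒬(Γ) → 𝒫(Γ) → (Λ³ H₁(Γ, ℂ))*` with last map `f ↦ f ∘ ε₃` is well defined
and exact, and the image of its last map is `𝓔(Γ)`. -/
theorem mainTheorem1 (Γ : Type) [Group Γ] [Group.FG Γ] :
    ∃ ε₃star : parallelogramFunctions Γ →ₗ[ℂ] Module.Dual ℂ (⋀[ℂ]^3 (hlg1 Γ)),
      (∀ (f : parallelogramFunctions Γ) (γ₁ γ₂ γ₃ : Γ),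
        ε₃star f (exteriorPower.ιMulti ℂ 3 ![cls γ₁, cls γ₂, cls γ₃]) =
          linearize (f : Γ → ℂ) (eps3 γ₁ γ₂ γ₃)) ∧
      Function.Injective (Submodule.inclusion (quadraticForms_le Γ)) ∧
      Function.Exact (Submodule.inclusion (quadraticForms_le Γ)) ε₃star ∧
      LinearMap.range ε₃star = cubicForms Γ := by
  refine ⟨eps3Dual Γ, eps3Dual_ιMulti, Submodule.inclusion_injective _, fun f => ?_, ?_⟩
  · rw [eps3Dual_eq_zero_iff]
    exact ⟨fun h => ⟨⟨f, h⟩, rfl⟩, fun ⟨q, hq⟩ => hq ▸ q.2⟩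
  · refine le_antisymm ?_ fun Φ hΦ => exists_eps3Dual_eq hΦ
    rintro _ ⟨f, rfl⟩
    exact eps3Dual_mem_cubicForms f
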